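/- **Setting.** For a real sequence $\theta=(\theta_j)_{j\ge 1}$ let $\boldsymbol\theta_k=(\theta_{2^k+l})_{0\le l<2^k}$, $k=0,1,2,\dots$, be its dyadic blocks. For $\alpha>0$, $2\le p\le\infty$, $1\le q\le\infty$, $Q>0$ and $s=\alpha+\tfrac12-\tfrac1p$ (with $1/\infty=0$) let $$B^\alpha_{p,q}(Q)=\Big\{\theta:\sum_{k\ge 0}2^{skq}\|\boldsymbol\theta_k\|_p^q\le Q^q\Big\},$$ where $\|\cdot\|_p$ is the vector $\ell^p$-norm; for $q=\infty$ the condition reads $\sup_k 2^{sk}\|\boldsymbol\theta_k\|_p\le Q$. For $k\ge0$ let $g_k$ be the probability density on $[0,\infty)$ $$g_k(t)=\begin{cases}2^{k^2}\big(2^{-2^k}-T_k\big)t+T_k,&0\le t\le 2^{-k^2},\\ 2^{-2^k},&2^{-k^2}<t\le 2^{-k},\\ 0,&t>2^{-k},\end{cases}\qquad T_k=2\cdot2^{k^2}-2\cdot 2^{-2^k+k^2-k}+2^{-2^k}.$$ The block prior $\bar\Pi$ is the law of the random sequence $\theta$ obtained by drawing $A_k\sim g_k$ independently over $k\ge0$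 and, given $(A_k)_k$, drawing the blocks $\boldsymbol\theta_k\sim N(0,A_kI_{2^k})$ independently over $k$. Put $\epsilon_n^2=n^{-2\alpha/(2\alpha+1)}$ and, for a fixed $\theta_0$ and $\beta>0$, $$\mathcal F_n(\beta)=\Big\{\theta:\sum_{k>(2\alpha+1)^{-1}\log_2(n\beta^{-1})}\|\boldsymbol\theta_k-\boldsymbol\theta_{0k}\|_2^2\le\epsilon_n^2\Big\}.$$ **Theorem.** Let $\alpha>0$, $2\le p\le\infty$, $1\le q\le\infty$, $Q>0$ and $\theta_0\in B^\alpha_{p,q}(Q)$. Then there is a constant $C>0$ such that for all sufficiently large $n$ $$\bar\Pi\Big\{\sum_{j=1}^\infty(\theta_j-\theta_{0j})^2\le\epsilon_n^2\Big\}\ge 2^{-Cn\epsilon_n^2},$$ and $$\bar\Pi\big(\mathcal F_n(\beta)^c\big)\le 2^{1-(C+4)n\epsilon_n^2}$$ for every $c_3>0$ with $\int_{2^{-k^2}}^\infty g_k(t)\,dt\le 2^{-c_3 2^k}$ for all $k\ge0$, and every $\beta$ with $$0<\beta\le\Big(\min\Big\{\frac{c_3}{2(C+4)},\,(4Q^2)^{-2\alpha}\Big\}\Big)^{2\alpha+1}.$$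 -/

import Mathlib

open MeasureTheory ProbabilityTheory Filter
open scoped ENNReal NNReal

namespace BlockPrior

noncomputable section

/-! ### Dyadic blocks of a sequence `θ₁, θ₂, …` -/

/-- The position `2 ^ k + l` of the `l`-th coordinate of the `k`-th block, `0 ≤ l < 2 ^ k`. -/
def blockIndex (k : ℕ) (l : Fin (2 ^ k)) : ℕ+ :=
  ⟨2 ^ k + l, Nat.add_pos_left (by positivity) _⟩

/-- The `k`-th block `(θ_{2^k}, …, θ_{2^{k+1}-1})` of the sequence `θ`. -/
def block (θ : ℕ+ → ℝ) (k : ℕ) : Fin (2 ^ k) → ℝ := fun l => θ (blockIndex k l)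

/-- The resolution level of the coordinate `j`, that is, the number `k` of its block. -/
def level (j : ℕ+) : ℕ := Nat.log 2 j

theorem level_blockIndex (k : ℕ) (l : Fin (2 ^ k)) : level (blockIndex k l) = k := by
  have hl := l.isLt
  unfold level blockIndex
  refine Nat.log_eq_of_pow_le_of_lt_pow ?_ ?_
  · simp
  · simp only [PNat.mk_coe, pow_succ]
    omega

/-! ### The Besov ball -/

/-- The Besov ball `B^α_{p,q}(Q)` of sequences, with `s = α + 1/2 - 1/p` (`1/∞ = 0`). The block
norms are the `ℓ^p` norms, and for `q = ∞` the sum over the levels is a supremum. -/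
def besovBall (α : ℝ) (p q : ℝ≥0∞) (Q : ℝ) : Set (ℕ+ → ℝ) :=
  {θ | if q = ∞ then
      ∀ k : ℕ, (2 : ℝ) ^ ((α + 1 / 2 - (p⁻¹).toReal) * k) * ‖WithLp.toLp p (block θ k)‖ ≤ Q
    else
      ∑' k : ℕ, ENNReal.ofReal ((2 : ℝ) ^ ((α + 1 / 2 - (p⁻¹).toReal) * k * q.toReal) *
        ‖WithLp.toLp p (block θ k)‖ ^ q.toReal) ≤ ENNReal.ofReal (Q ^ q.toReal)}

/-! ### The mixing densities -/

/-- The value `T_k` of the `k`-th mixing density at `0`. -/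
def mixT (k : ℕ) : ℝ :=
  2 * (2 : ℝ) ^ ((k : ℝ) ^ 2) - 2 * (2 : ℝ) ^ (-(2 : ℝ) ^ (k : ℝ) + (k : ℝ) ^ 2 - k)
    + (2 : ℝ) ^ (-(2 : ℝ) ^ (k : ℝ))

/-- The `k`-th mixing density `g_k` (extended by `0` to the negative half-line). -/
def mixDensity (k : ℕ) (t : ℝ) : ℝ :=
  if t < 0 then 0
  else if t ≤ (2 : ℝ) ^ (-(k : ℝ) ^ 2) then
    (2 : ℝ) ^ ((k : ℝ) ^ 2) * ((2 : ℝ) ^ (-(2 : ℝ) ^ (k : ℝ)) - mixT k) * t + mixT k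
  else if t ≤ (2 : ℝ) ^ (-(k : ℝ)) then (2 : ℝ) ^ (-(2 : ℝ) ^ (k : ℝ))
  else 0

/-- The law on `ℝ` with density `g_k`. -/
def mixLaw (k : ℕ) : Measure ℝ :=
  volume.withDensity fun t => ENNReal.ofReal (mixDensity k t)

/-- The tail property of the mixing densities with constant `c₃`:
`∫_{2^{-k²}}^∞ g_k(t) dt ≤ 2^{-c₃ 2^k}` for every `k`. -/
def MixTail (c₃ : ℝ) : Prop :=
  ∀ k : ℕ, ∫⁻ t in Set.Ioi ((2 : ℝ) ^ (-(k : ℝ) ^ 2)), ENNReal.ofReal (mixDensity k t)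
    ≤ ENNReal.ofReal ((2 : ℝ) ^ (-c₃ * (2 : ℝ) ^ (k : ℝ)))

theorem mixT_nonneg (k : ℕ) : 0 ≤ mixT k := by
  have h : (2 : ℝ) ^ (-(2 : ℝ) ^ (k : ℝ) + (k : ℝ) ^ 2 - k) ≤ (2 : ℝ) ^ ((k : ℝ) ^ 2) := by
    apply Real.rpow_le_rpow_of_exponent_le one_le_two
    have h1 : (0 : ℝ) ≤ (2 : ℝ) ^ (k : ℝ) := by positivity
    have h2 : (0 : ℝ) ≤ k := by positivity
    linarith
  have h3 : (0 : ℝ) ≤ (2 : ℝ) ^ (-(2 : ℝ) ^ (k : ℝ)) := by positivity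
  unfold mixT
  linarith

theorem lintegral_ofReal_mix_eq_one {a b h T : ℝ} (ha : 0 < a) (hab : a ≤ b) (hh : 0 ≤ h)
    (hT : 0 ≤ T) (g : ℝ → ℝ) (hg : ∀ t, g t = if t < 0 then 0 else if t ≤ a then
      a⁻¹ * (h - T) * t + T else if t ≤ b then h else 0)
    (htot : a * (h + T) / 2 + (b - a) * h = 1) :
    ∫⁻ t, ENNReal.ofReal (g t) = 1 := by
  have hsplit : ∀ t, ENNReal.ofReal (g t) =
      (Set.Icc 0 a).indicator (fun t => ENNReal.ofReal (a⁻¹ * (h - T) * t + T)) t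
        + (Set.Ioc a b).indicator (fun _ => ENNReal.ofReal h) t := by
    intro t
    rw [hg]
    simp only [Set.indicator_apply, Set.mem_Icc, Set.mem_Ioc]
    split_ifs <;> first | (exfalso; grind) | simp
  have hlin : ∀ t ∈ Set.Icc 0 a, 0 ≤ a⁻¹ * (h - T) * t + T := by
    intro t ht
    have h1 : 0 ≤ a⁻¹ * t := by have := ht.1; positivity
    have h2 : a⁻¹ * t ≤ 1 := by
      rw [inv_mul_le_one₀ ha]; exact ht.2
    nlinarith [mul_nonneg h1 hh, mul_nonneg (sub_nonneg.2 h2) hT]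
  have hint : ∫ t in Set.Icc 0 a, (a⁻¹ * (h - T) * t + T) = a * (h + T) / 2 := by
    rw [integral_Icc_eq_integral_Ioc, ← intervalIntegral.integral_of_le ha.le,
      intervalIntegral.integral_add (by apply Continuous.intervalIntegrable; fun_prop)
        (by apply Continuous.intervalIntegrable; fun_prop),
      intervalIntegral.integral_const_mul, integral_id]
    simp
    field_simp
    ring
  simp_rw [hsplit]
  rw [lintegral_add_left (Measurable.indicator (by fun_prop) measurableSet_Icc),
    lintegral_indicator measurableSet_Icc, lintegral_indicator measurableSet_Ioc,
    ← ofReal_integral_eq_lintegral_ofReal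
      ((by fun_prop : Continuous fun t : ℝ => a⁻¹ * (h - T) * t + T).continuousOn.integrableOn_Icc)
      ((ae_restrict_iff' measurableSet_Icc).2 (ae_of_all _ hlin)), hint]
  rw [setLIntegral_const, Real.volume_Ioc, ← ENNReal.ofReal_mul hh,
    ← ENNReal.ofReal_add (by positivity) (mul_nonneg hh (sub_nonneg.2 hab)), mul_comm h, htot,
    ENNReal.ofReal_one]

instance isProbabilityMeasure_mixLaw (k : ℕ) : IsProbabilityMeasure (mixLaw k) := by
  constructor
  rw [mixLaw, withDensity_apply _ MeasurableSet.univ, Measure.restrict_univ]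
  have hk : (k : ℝ) ≤ (k : ℝ) ^ 2 := by exact_mod_cast Nat.le_self_pow two_ne_zero k
  refine lintegral_ofReal_mix_eq_one (a := (2 : ℝ) ^ (-(k : ℝ) ^ 2))
    (b := (2 : ℝ) ^ (-(k : ℝ))) (h := (2 : ℝ) ^ (-(2 : ℝ) ^ (k : ℝ))) (T := mixT k)
    (by positivity) (Real.rpow_le_rpow_of_exponent_le one_le_two (by linarith)) (by positivity)
    (mixT_nonneg k) _ (fun t => ?_) ?_
  · rw [mixDensity, Real.rpow_neg two_pos.le ((k : ℝ) ^ 2), inv_inv]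
  · have e : (2 : ℝ) ^ (-(2 : ℝ) ^ (k : ℝ) + (k : ℝ) ^ 2 - k)
        = (2 : ℝ) ^ (-(2 : ℝ) ^ (k : ℝ)) * (2 : ℝ) ^ ((k : ℝ) ^ 2) * (2 : ℝ) ^ (-(k : ℝ)) := by
      rw [← Real.rpow_add two_pos, ← Real.rpow_add two_pos]; rfl
    have f : (2 : ℝ) ^ (-(k : ℝ) ^ 2) * (2 : ℝ) ^ ((k : ℝ) ^ 2) = 1 := by
      rw [← Real.rpow_add two_pos]; simp
    rw [mixT, e]
    linear_combination (1 - (2 : ℝ) ^ (-(2 : ℝ) ^ (k : ℝ)) * (2 : ℝ) ^ (-(k : ℝ))) * f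

/-! ### The block prior -/

/-- The law of `θ` given the scales `A = (A_k)`: the coordinates are independent, and those of the
`k`-th block are `N(0, A_k)`. -/
def gaussianBlocks (A : ℕ → ℝ) : Measure (ℕ+ → ℝ) :=
  Measure.infinitePi fun j => gaussianReal 0 (A (level j)).toNNReal

theorem gaussianBlocks_eq_map (A : ℕ → ℝ) :
    gaussianBlocks A = (Measure.infinitePi fun _ : ℕ+ => gaussianReal 0 1).map
      fun z j => √(A (level j)) * z j := by
  rw [gaussianBlocks, Measure.infinitePi_map_pi _ (fun j => by fun_prop)]
  congr 1
  funext j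
  rw [gaussianReal_map_const_mul]
  congr 1
  · simp
  · ext
    rcases le_total 0 (A (level j)) with h | h
    · simp [h]
    · simp [Real.sqrt_eq_zero_of_nonpos h, h]

theorem measurable_gaussianBlocks : Measurable gaussianBlocks := by
  refine Measure.measurable_of_measurable_coe _ fun s hs => ?_
  have hm : Measurable fun x : (ℕ → ℝ) × (ℕ+ → ℝ) => fun j : ℕ+ => √(x.1 (level j)) * x.2 j := by
    fun_prop
  have h := measurable_measure_prodMk_left
    (ν := Measure.infinitePi fun _ : ℕ+ => gaussianReal 0 1) (hm hs)
  convert h using 2 with A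
  rw [gaussianBlocks_eq_map, Measure.map_apply (by fun_prop) hs]
  rfl

/-- The conditional law of `θ` given the scales, as a Markov kernel. -/
def gaussianKernel : Kernel (ℕ → ℝ) (ℕ+ → ℝ) := ⟨gaussianBlocks, measurable_gaussianBlocks⟩

/-- The block prior: the scales `A_k` are independent with `A_k ∼ g_k`, and given the scales the
blocks of `θ` are independent with law `N(0, A_k I)` of dimension `2 ^ k`. -/
def prior : Measure (ℕ+ → ℝ) := (Measure.infinitePi mixLaw).bind gaussianKernel

/-! ### The rate and the two events -/

/-- The squared minimax rate `ε_n² = n^{-2α/(2α+1)}`. -/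
def rateSq (α : ℝ) (n : ℕ) : ℝ := (n : ℝ) ^ (-(2 * α / (2 * α + 1)))

/-- The `ℓ²` ball `∑_j (θ_j - θ₀_j)² ≤ ε_n²`; a divergent series counts as `∞`. -/
def l2Ball (α : ℝ) (θ₀ : ℕ+ → ℝ) (n : ℕ) : Set (ℕ+ → ℝ) :=
  {θ | ∑' j : ℕ+, ENNReal.ofReal ((θ j - θ₀ j) ^ 2) ≤ ENNReal.ofReal (rateSq α n)}

/-- The sieve `ℱ_n(β)`: the sum of the squared `ℓ²` norms of the blocks of `θ - θ₀` over the levels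
`k > (2α+1)⁻¹ log₂ (n β⁻¹)` is at most `ε_n²`; a divergent series counts as `∞`. -/
def sieve (α β : ℝ) (θ₀ : ℕ+ → ℝ) (n : ℕ) : Set (ℕ+ → ℝ) :=
  {θ | ∑' k : {k : ℕ // (2 * α + 1)⁻¹ * Real.logb 2 (n * β⁻¹) < k},
      ENNReal.ofReal (∑ l : Fin (2 ^ (k : ℕ)), (block θ k l - block θ₀ k l) ^ 2)
    ≤ ENNReal.ofReal (rateSq α n)}

end

end BlockPrior

open MeasureTheory ProbabilityTheory Filter
open scoped ENNReal NNReal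

namespace BlockPrior

/-! Write `N = n ε_n² = n^{1/(2α+1)}`, so that `ε_n² = N^{-2α}`. Only one consequence of the Besov
condition matters: the blocks of `θ₀` satisfy `‖θ₀_k‖₂² ≤ Q² 2^{-2αk}` (`sum_block_sq_le`). Levels
are split at a cut-off `J`.

High levels, `k ≥ J`: outside an event of probability at most `2^{-2^k}` the scale is below
`2^{-k²}`. This is so small that a coordinate violates `θ_j² ≤ ε_n² / (8·4^k)` with conditional
probability at most `2·2^{-2^k}`. A union bound over all these coordinates gives at most
`2·2^{-2^J/2}` (`prior_largeTail_le`). If no violation occurs, the tail of `θ - θ₀` contributes at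
most `ε_n²/2` (`tsum_block_sub_sq_le`). With `2^J ≥ 2(C+4)N` this is the sieve bound.

Low levels, `k < J`, with `2^J` of order `N`: the scale is asked to lie within a factor 2 of
`2^{-(2α+1)k}`, the variance natural for smoothness `α`. As `g_k ≥ 2^{-2^k}` on `[0, 2^{-k}]`, this
costs a factor `2^{-O(2^k)}`. Given such a scale, a coordinate is close enough to `θ₀_j` at the cost
of an exponent `O(J - k)` plus a multiple of `θ₀_j² 2^{(2α+1)k}`. Summed over all coordinates, both
are `O(2^J) = O(N)`. The high levels only cost constant factors, and the small ball bound follows.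
-/

/-! ### Products of probability measures -/

/-- Lower bound for the measure of a box under an infinite product measure: the finitely many
factors in `F` are kept, and the other ones are handled by a union bound. -/
theorem prod_mul_one_sub_le_infinitePi {ι : Type*} [Countable ι] {X : ι → Type*}
    [∀ i, MeasurableSpace (X i)] (μ : ∀ i, Measure (X i)) [∀ i, IsProbabilityMeasure (μ i)]
    {s : ∀ i, Set (X i)} (hs : ∀ i, MeasurableSet (s i)) (F : Finset ι) {δ : ℝ≥0∞}
    (u : ι → ℝ≥0∞) (hu : ∀ i ∉ F, μ i (s i)ᶜ ≤ u i) (hδ : ∑' i, u i ≤ δ) :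
    (∏ i ∈ F, μ i (s i)) * (1 - δ) ≤ Measure.infinitePi μ (Set.univ.pi s) := by
  classical
  rw [Measure.infinitePi_pi_univ μ hs, ENNReal.tprod_eq_iInf_prod (by simp [prob_le_one])]
  refine le_iInf fun S => ?_
  -- The factors are at most 1, so adding the missing indices of `F` only lowers the product.
  have h1 : ∏ i ∈ F ∪ S \ F, μ i (s i) ≤ ∏ i ∈ S, μ i (s i) :=
    Finset.prod_le_prod_of_subset_of_le_one' (by intro i hi; by_cases i ∈ F <;> simp_all)
      fun i _ _ => prob_le_one
  refine le_trans ?_ h1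
  rw [Finset.prod_union Finset.disjoint_sdiff]
  gcongr
  rw [← Measure.infinitePi_pi μ (fun i _ => hs i), tsub_le_iff_left]
  have h2 : Measure.infinitePi μ (Set.pi (S \ F : Finset ι) s)ᶜ ≤ δ := by
    have hsub : (Set.pi (S \ F : Finset ι) s)ᶜ
        ⊆ ⋃ i ∈ S \ F, Function.eval i ⁻¹' (s i)ᶜ := by
      intro x hx
      simpa [Set.mem_pi, and_assoc] using hx
    calc _ ≤ ∑ i ∈ S \ F, Measure.infinitePi μ (Function.eval i ⁻¹' (s i)ᶜ) :=
          (measure_mono hsub).trans (measure_biUnion_finset_le _ _)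
      _ ≤ ∑ i ∈ S \ F, u i := by
          refine Finset.sum_le_sum fun i hi => ?_
          rw [(measurePreserving_eval_infinitePi μ i).measure_preimage
            (hs i).compl.nullMeasurableSet]
          exact hu i (Finset.mem_sdiff.1 hi).2
      _ ≤ δ := (ENNReal.sum_le_tsum _).trans hδ
  calc (1 : ℝ≥0∞) = Measure.infinitePi μ Set.univ := by simp
    _ ≤ _ := by
      rw [← Set.compl_union_self (Set.pi (S \ F : Finset ι) s)]
      refine (measure_union_le _ _).trans ?_
      gcongr

/-! ### Gaussian bounds -/

/-- Chernoff's bound on both sides, with `A` as variance proxy: the estimate is uniform over `v ≤ A`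
and includes the degenerate law `v = 0`. -/
theorem gaussianReal_lt_sq_le {v A : ℝ≥0} (hv : v ≤ A) {y : ℝ} (hy : 0 ≤ y) :
    gaussianReal 0 v {x | y < x ^ 2} ≤ ENNReal.ofReal (2 * Real.exp (-y / (2 * A))) := by
  have hid : HasSubgaussianMGF (fun x : ℝ => x) A (gaussianReal 0 v) := by
    refine ⟨fun t => integrable_exp_mul_gaussianReal t, fun t => ?_⟩
    rw [mgf_fun_id_gaussianReal]
    have : (v : ℝ) ≤ A := hv
    simp only [zero_mul, zero_add]
    gcongr
  have hneg := hid.neg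
  have h1 := hid.measure_ge_le (Real.sqrt_nonneg y)
  have h2 := hneg.measure_ge_le (Real.sqrt_nonneg y)
  rw [Real.sq_sqrt hy] at h1 h2
  have hsub : {x : ℝ | y < x ^ 2} ⊆ {x | √y ≤ x} ∪ {x | √y ≤ (-fun x : ℝ => x) x} := by
    intro x hx
    have : √y ≤ |x| := by
      rw [← Real.sqrt_sq_eq_abs]
      exact Real.sqrt_le_sqrt (le_of_lt hx)
    rcases abs_cases x with h | h
    · left; simp only [Set.mem_ofPred_eq]; linarith
    · right; simp only [Set.mem_ofPred_eq, Pi.neg_apply]; linarith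
  rw [← ofReal_measureReal]
  refine ENNReal.ofReal_le_ofReal ?_
  refine (measureReal_mono hsub).trans ((measureReal_union_le _ _).trans ?_)
  linarith

/-- Length of the interval times a lower bound for the density on it. There `x² ≤ 2(μ² + η)`; `a ≤
b` controls the normalization and `b/2 ≤ a` the exponent. -/
theorem le_gaussianReal_sq_sub_le {a b η μ : ℝ} (hb : 0 < b) (hab : b / 2 ≤ a) (ha : a ≤ b)
    (hη : 0 ≤ η) :
    ENNReal.ofReal (2 * √η * ((√(2 * Real.pi * b))⁻¹ * Real.exp (-(2 * (μ ^ 2 + η) / b))))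
      ≤ gaussianReal 0 a.toNNReal {x | (x - μ) ^ 2 ≤ η} := by
  have ha0 : 0 < a := by linarith
  have hset : {x : ℝ | (x - μ) ^ 2 ≤ η} = Set.Icc (μ - √η) (μ + √η) := by
    ext x
    simp only [Set.mem_ofPred_eq, Set.mem_Icc]
    rw [Real.sq_le hη]
    constructor <;> rintro ⟨h1, h2⟩ <;> constructor <;> linarith
  have hv : a.toNNReal ≠ 0 := by simpa using ha0
  rw [gaussianReal_apply _ hv]
  calc _ = ∫⁻ _ in {x : ℝ | (x - μ) ^ 2 ≤ η},
        ENNReal.ofReal ((√(2 * Real.pi * b))⁻¹ * Real.exp (-(2 * (μ ^ 2 + η) / b))) := by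
        rw [setLIntegral_const, hset, Real.volume_Icc, ← ENNReal.ofReal_mul (by positivity)]
        congr 1
        ring
    _ ≤ _ := by
        refine setLIntegral_mono (measurable_gaussianPDF _ _) fun x hx => ?_
        rw [gaussianPDF_def]
        refine ENNReal.ofReal_le_ofReal ?_
        rw [gaussianPDFReal_def]
        simp only [Real.coe_toNNReal _ ha0.le, sub_zero]
        have hx2 : x ^ 2 ≤ 2 * (μ ^ 2 + η) := by
          have : (x - μ) ^ 2 ≤ η := hx
          nlinarith [sq_nonneg (x - 2 * μ)]
        have hexp : x ^ 2 / (2 * a) ≤ 2 * (μ ^ 2 + η) / b := by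
          rw [div_le_div_iff₀ (by positivity) hb]
          have : 0 ≤ μ ^ 2 + η := by positivity
          nlinarith
        gcongr
        rw [neg_div]
        exact neg_le_neg hexp

/-! ### The prior -/

theorem prior_apply {E : Set (ℕ+ → ℝ)} (hE : MeasurableSet E) :
    prior E = ∫⁻ A, gaussianBlocks A E ∂Measure.infinitePi mixLaw := by
  rw [prior, Measure.bind_apply hE gaussianKernel.measurable.aemeasurable]
  rfl

/-- `B` plays the role of the exceptional set of scales, on which the conditional probability is
bounded by 1. -/
theorem prior_coord_le (j : ℕ+) {s B : Set ℝ} (hs : MeasurableSet s) (hB : MeasurableSet B)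
    {δ : ℝ≥0∞} (h : ∀ a ∉ B, gaussianReal 0 a.toNNReal s ≤ δ) :
    prior ((fun θ => θ j) ⁻¹' s) ≤ mixLaw (level j) B + δ := by
  rw [prior_apply (measurable_pi_apply j hs)]
  have hpt : ∀ A : ℕ → ℝ, gaussianBlocks A ((fun θ => θ j) ⁻¹' s)
      ≤ (Function.eval (level j) ⁻¹' B).indicator 1 A + δ := by
    intro A
    have he : gaussianBlocks A ((fun θ => θ j) ⁻¹' s)
        = gaussianReal 0 (A (level j)).toNNReal s :=
      (measurePreserving_eval_infinitePi (fun j => gaussianReal 0 (A (level j)).toNNReal)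
        j).measure_preimage hs.nullMeasurableSet
    rw [he]
    by_cases hA : A (level j) ∈ B
    · refine prob_le_one.trans ?_
      simp [hA]
    · exact (h _ hA).trans le_add_self
  refine (lintegral_mono hpt).trans ?_
  have hm : MeasurableSet (Function.eval (level j) ⁻¹' B : Set (ℕ → ℝ)) :=
    measurable_pi_apply _ hB
  rw [lintegral_add_right _ measurable_const, lintegral_const, measure_univ, mul_one,
    lintegral_indicator_one hm,
    (measurePreserving_eval_infinitePi mixLaw _).measure_preimage hB.nullMeasurableSet]

theorem mul_le_prior {E : Set (ℕ+ → ℝ)} (hE : MeasurableSet E) {G : Set (ℕ → ℝ)}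
    (hG : MeasurableSet G) {c : ℝ≥0∞} (h : ∀ A ∈ G, c ≤ gaussianBlocks A E) :
    c * Measure.infinitePi mixLaw G ≤ prior E := by
  rw [prior_apply hE, ← setLIntegral_const]
  exact (setLIntegral_mono' hG h).trans (setLIntegral_le_lintegral _ _)

/-! ### The mixing densities -/

theorem measurable_mixDensity (k : ℕ) : Measurable (mixDensity k) := by
  unfold mixDensity
  refine Measurable.ite measurableSet_Iio measurable_const
    (Measurable.ite measurableSet_Iic (by fun_prop)
      (Measurable.ite measurableSet_Iic measurable_const measurable_const))

theorem setLIntegral_mixDensity_Ioi (k : ℕ) :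
    ∫⁻ t in Set.Ioi ((2 : ℝ) ^ (-(k : ℝ) ^ 2)), ENNReal.ofReal (mixDensity k t)
      = ENNReal.ofReal ((2 : ℝ) ^ (-(2 : ℝ) ^ (k : ℝ)) *
          ((2 : ℝ) ^ (-(k : ℝ)) - (2 : ℝ) ^ (-(k : ℝ) ^ 2))) := by
  have h0 : (0 : ℝ) < (2 : ℝ) ^ (-(k : ℝ) ^ 2) := by positivity
  calc _ = ∫⁻ t in Set.Ioi ((2 : ℝ) ^ (-(k : ℝ) ^ 2)), (Set.Iic ((2 : ℝ) ^ (-(k : ℝ)))).indicator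
        (fun _ => ENNReal.ofReal ((2 : ℝ) ^ (-(2 : ℝ) ^ (k : ℝ)))) t := by
        refine setLIntegral_congr_fun measurableSet_Ioi fun t ht => ?_
        have ht' : (2 : ℝ) ^ (-(k : ℝ) ^ 2) < t := ht
        simp only [mixDensity, Set.indicator_apply, Set.mem_Iic]
        rw [if_neg (by linarith), if_neg (by linarith)]
        split_ifs <;> simp
    _ = _ := by
        rw [setLIntegral_indicator measurableSet_Iic, setLIntegral_const, Set.inter_comm,
          Set.Ioi_inter_Iic, Real.volume_Ioc, ENNReal.ofReal_mul (by positivity)]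

theorem mixLaw_Ioi_le (k : ℕ) :
    mixLaw k (Set.Ioi ((2 : ℝ) ^ (-(k : ℝ) ^ 2)))
      ≤ ENNReal.ofReal ((2 : ℝ) ^ (-(2 : ℝ) ^ (k : ℝ))) := by
  rw [mixLaw, withDensity_apply _ measurableSet_Ioi, setLIntegral_mixDensity_Ioi]
  refine ENNReal.ofReal_le_ofReal (mul_le_of_le_one_right (by positivity) ?_)
  have h1 : (2 : ℝ) ^ (-(k : ℝ)) ≤ 1 := Real.rpow_le_one_of_one_le_of_nonpos one_le_two (by simp)
  have h2 : (0 : ℝ) ≤ (2 : ℝ) ^ (-(k : ℝ) ^ 2) := by positivity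
  linarith

/-- The linear piece interpolates between `T_k ≥ 2^{-2^k}` and the plateau value `2^{-2^k}`. -/
theorem two_rpow_le_mixDensity {k : ℕ} {t : ℝ} (h0 : 0 ≤ t) (ht : t ≤ (2 : ℝ) ^ (-(k : ℝ))) :
    (2 : ℝ) ^ (-(2 : ℝ) ^ (k : ℝ)) ≤ mixDensity k t := by
  rw [mixDensity, if_neg (by linarith)]
  split_ifs with h1
  · have hT : (2 : ℝ) ^ (-(2 : ℝ) ^ (k : ℝ)) ≤ mixT k := by
      have h : (2 : ℝ) ^ (-(2 : ℝ) ^ (k : ℝ) + (k : ℝ) ^ 2 - k) ≤ (2 : ℝ) ^ ((k : ℝ) ^ 2) := by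
        apply Real.rpow_le_rpow_of_exponent_le one_le_two
        have h1 : (0 : ℝ) ≤ (2 : ℝ) ^ (k : ℝ) := by positivity
        have h2 : (0 : ℝ) ≤ k := by positivity
        linarith
      unfold mixT
      linarith
    have h2 : (2 : ℝ) ^ ((k : ℝ) ^ 2) * t ≤ 1 := by
      calc _ ≤ (2 : ℝ) ^ ((k : ℝ) ^ 2) * (2 : ℝ) ^ (-(k : ℝ) ^ 2) := by gcongr
        _ = 1 := by rw [← Real.rpow_add two_pos]; simp
    nlinarith [mul_nonneg (sub_nonneg.2 h2) (sub_nonneg.2 hT)]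
  · exact le_rfl

theorem le_mixLaw_Icc {k : ℕ} {a b : ℝ} (ha : 0 ≤ a) (hb : b ≤ (2 : ℝ) ^ (-(k : ℝ))) :
    ENNReal.ofReal ((2 : ℝ) ^ (-(2 : ℝ) ^ (k : ℝ)) * (b - a)) ≤ mixLaw k (Set.Icc a b) := by
  rw [mixLaw, withDensity_apply _ measurableSet_Icc, ENNReal.ofReal_mul (by positivity),
    ← Real.volume_Icc, ← setLIntegral_const]
  refine setLIntegral_mono (measurable_mixDensity k).ennreal_ofReal fun t ht => ?_
  exact ENNReal.ofReal_le_ofReal (two_rpow_le_mixDensity (ha.trans ht.1) (ht.2.trans hb))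

/-- For `k ≥ 2` the exact tail mass is at least `2^{-2^k - k - 1}`, hence `c 2^k ≤ 2^k + k + 1`; let
`k → ∞`. For `k ≤ 1` the tail mass vanishes and gives no information. -/
theorem MixTail.le_one {c : ℝ} (hc : MixTail c) : c ≤ 1 := by
  have key : ∀ k : ℕ, 2 ≤ k → c - 1 ≤ ((k : ℝ) + 1) / 2 ^ k := by
    intro k hk
    have hk' : (2 : ℝ) ≤ k := by exact_mod_cast hk
    have h := hc k
    rw [setLIntegral_mixDensity_Ioi, ENNReal.ofReal_le_ofReal_iff (by positivity)] at h
    have h1 : (2 : ℝ) ^ (-(k : ℝ) ^ 2) ≤ (2 : ℝ) ^ (-(k : ℝ) - 1) :=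
      Real.rpow_le_rpow_of_exponent_le one_le_two (by nlinarith)
    have h2 : (2 : ℝ) ^ (-(k : ℝ)) = 2 * (2 : ℝ) ^ (-(k : ℝ) - 1) := by
      rw [Real.rpow_sub two_pos, Real.rpow_one]; ring
    have h3 :
        (2 : ℝ) ^ (-(2 : ℝ) ^ (k : ℝ) + (-(k : ℝ) - 1)) ≤ (2 : ℝ) ^ (-c * (2 : ℝ) ^ (k : ℝ)) := by
      rw [Real.rpow_add two_pos]
      refine le_trans ?_ h
      gcongr
      linarith
    rw [Real.rpow_le_rpow_left_iff one_lt_two, Real.rpow_natCast] at h3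
    rw [le_div_iff₀ (by positivity)]
    linarith
  have hlim : Tendsto (fun k : ℕ => ((k : ℝ) + 1) / 2 ^ k) atTop (nhds 0) := by
    have h1 := tendsto_pow_const_div_const_pow_of_one_lt 1 (r := (2 : ℝ)) one_lt_two
    have h2 := tendsto_pow_const_div_const_pow_of_one_lt 0 (r := (2 : ℝ)) one_lt_two
    simpa [add_div] using h1.add h2
  have := ge_of_tendsto hlim ((eventually_ge_atTop 2).mono key)
  linarith

/-! ### Blocks of Besov sequences -/

/-- For finite `p` this is the power mean inequality for the numbers `x_i²` with exponent `p/2 ≥ 1`.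
-/
theorem sum_sq_le_card_rpow_mul_norm_sq {ι : Type*} [Fintype ι] [Nonempty ι] {p : ℝ≥0∞}
    (hp : 2 ≤ p) (x : ι → ℝ) :
    ∑ i, x i ^ 2 ≤ (Fintype.card ι : ℝ) ^ (1 - 2 * (p⁻¹).toReal) * ‖WithLp.toLp p x‖ ^ 2 := by
  rcases eq_or_ne p ∞ with rfl | hp'
  · have h : ∀ i, x i ^ 2 ≤ ‖WithLp.toLp ∞ x‖ ^ 2 := by
      intro i
      rw [← sq_abs]
      gcongr
      exact PiLp.norm_apply_le (WithLp.toLp ∞ x) i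
    calc ∑ i, x i ^ 2 ≤ ∑ _i : ι, ‖WithLp.toLp ∞ x‖ ^ 2 := Finset.sum_le_sum fun i _ => h i
      _ = _ := by simp
  · have hp2 : 2 ≤ p.toReal := by
      simpa using ENNReal.toReal_mono hp' hp
    have hp0 : 0 < p.toReal := by linarith
    set r := p.toReal with hr
    have h := Real.rpow_sum_le_const_mul_sum_rpow_of_nonneg (s := Finset.univ)
      (f := fun i => x i ^ 2) (p := r / 2) (by linarith) (fun i _ => sq_nonneg _)
    have hS : (∑ i, |x i| ^ r) = ∑ i, (x i ^ 2) ^ (r / 2) := by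
      refine Finset.sum_congr rfl fun i _ => ?_
      rw [← sq_abs, ← Real.rpow_natCast, ← Real.rpow_mul (abs_nonneg _)]
      congr 1
      push_cast
      ring
    rw [PiLp.norm_eq_sum hp0]
    simp only [Real.norm_eq_abs]
    rw [hS]
    have hnn : 0 ≤ ∑ i, (x i ^ 2) ^ (r / 2) :=
      Finset.sum_nonneg fun i _ => Real.rpow_nonneg (sq_nonneg _) _
    have hx : 0 ≤ ∑ i, x i ^ 2 := Finset.sum_nonneg fun i _ => sq_nonneg _
    have hc : (0 : ℝ) ≤ (Fintype.card ι : ℝ) := by positivity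
    calc ∑ i, x i ^ 2 = ((∑ i, x i ^ 2) ^ (r / 2)) ^ (2 / r) := by
          rw [← Real.rpow_mul hx]
          field_simp
          simp
      _ ≤ ((Fintype.card ι : ℝ) ^ (r / 2 - 1) * ∑ i, (x i ^ 2) ^ (r / 2)) ^ (2 / r) := by
          gcongr
          simpa using h
      _ = _ := by
          rw [Real.mul_rpow (by positivity) hnn, ← Real.rpow_mul hc, ← Real.rpow_natCast,
            ← Real.rpow_mul hnn, ENNReal.toReal_inv, ← hr]
          congr 2
          · field_simp
          · push_cast
            ring

theorem two_rpow_mul_norm_block_le {α Q : ℝ} {p q : ℝ≥0∞} (hq : 1 ≤ q) (hQ : 0 < Q)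
    {θ : ℕ+ → ℝ} (hθ : θ ∈ besovBall α p q Q) (k : ℕ) (hn : 0 ≤ ‖WithLp.toLp p (block θ k)‖) :
    (2 : ℝ) ^ ((α + 1 / 2 - (p⁻¹).toReal) * k) * ‖WithLp.toLp p (block θ k)‖ ≤ Q := by
  simp only [besovBall, Set.mem_ofPred_eq] at hθ
  split_ifs at hθ with hq'
  · exact hθ k
  · have hq0 : 0 < q.toReal := ENNReal.toReal_pos (by positivity) hq'
    have h := (ENNReal.le_tsum k).trans hθ
    rw [ENNReal.ofReal_le_ofReal_iff (by positivity), Real.rpow_mul two_pos.le,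
      ← Real.mul_rpow (by positivity) hn] at h
    exact (Real.rpow_le_rpow_iff (by positivity) hQ.le hq0).1 h

/-- Passing from `ℓ^p` to `ℓ²` on `2^k` coordinates costs `2^{k(1 - 2/p)}`, and `1 - 2/p - 2s =
-2α`: the index `p` cancels. -/
theorem sum_block_sq_le {α Q : ℝ} {p q : ℝ≥0∞} (hp : 2 ≤ p) (hq : 1 ≤ q) (hQ : 0 < Q)
    {θ : ℕ+ → ℝ} (hθ : θ ∈ besovBall α p q Q) (k : ℕ) :
    ∑ l, block θ k l ^ 2 ≤ Q ^ 2 * ((2 : ℝ) ^ (-(2 * α))) ^ k := by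
  have : Fact (1 ≤ p) := ⟨le_trans (by norm_num) hp⟩
  have hn : 0 ≤ ‖WithLp.toLp p (block θ k)‖ := norm_nonneg _
  have h1 := two_rpow_mul_norm_block_le hq hQ hθ k hn
  have h2 := sum_sq_le_card_rpow_mul_norm_sq hp (block θ k)
  set s := α + 1 / 2 - (p⁻¹).toReal with hs
  set N := ‖WithLp.toLp p (block θ k)‖
  refine h2.trans ?_
  have h3 : N ≤ Q * (2 : ℝ) ^ (-(s * k)) := by
    rw [Real.rpow_neg two_pos.le, ← div_eq_mul_inv, le_div_iff₀ (by positivity), mul_comm]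
    exact h1
  calc _ ≤ ((Fintype.card (Fin (2 ^ k)) : ℕ) : ℝ) ^ (1 - 2 * (p⁻¹).toReal)
        * (Q * (2 : ℝ) ^ (-(s * k))) ^ 2 := by gcongr
    _ = Q ^ 2 * ((2 : ℝ) ^ (k * (1 - 2 * (p⁻¹).toReal) + (-(s * k)) * 2)) := by
        rw [Fintype.card_fin, mul_pow, Real.rpow_add two_pos, Real.rpow_mul two_pos.le (k : ℝ),
          Real.rpow_mul two_pos.le (-(s * k)), Real.rpow_natCast]
        push_cast
        rw [Real.rpow_two]
        ring
    _ = _ := by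
        rw [← Real.rpow_mul_natCast two_pos.le]
        congr 2
        rw [hs]
        ring

/-! ### Summation along the blocks -/

theorem bijective_blockIndex :
    Function.Bijective fun x : (k : ℕ) × Fin (2 ^ k) => blockIndex x.1 x.2 := by
  constructor
  · rintro ⟨k, l⟩ ⟨k', l'⟩ h
    have hk : k = k' := by
      rw [← level_blockIndex k l, ← level_blockIndex k' l']
      exact congrArg level h
    subst hk
    have := congrArg PNat.val h
    simp only [blockIndex, PNat.mk_coe] at this
    simp only [Sigma.mk.injEq, heq_eq_eq, true_and]
    ext
    omega
  · intro j
    have h1 : 2 ^ Nat.log 2 j ≤ (j : ℕ) := Nat.pow_log_le_self 2 j.ne_zero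
    have h2 : (j : ℕ) < 2 ^ (Nat.log 2 j + 1) := Nat.lt_pow_succ_log_self one_lt_two _
    rw [pow_succ] at h2
    refine ⟨⟨Nat.log 2 j, ⟨j - 2 ^ Nat.log 2 j, by omega⟩⟩, ?_⟩
    apply PNat.eq
    simp only [blockIndex, PNat.mk_coe]
    omega

theorem tsum_eq_tsum_block (f : ℕ+ → ℝ≥0∞) :
    ∑' j, f j = ∑' k, ∑ l : Fin (2 ^ k), f (blockIndex k l) := by
  rw [← (Equiv.ofBijective _ bijective_blockIndex).tsum_eq f, ENNReal.tsum_sigma']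
  simp [tsum_fintype]

theorem tsum_ite_le_eq_tsum_add (J : ℕ) (f : ℕ → ℝ≥0∞) :
    ∑' k, (if J ≤ k then f k else 0) = ∑' i, f (i + J) := by
  have h : Function.Injective fun i : ℕ => i + J := add_left_injective J
  rw [← h.tsum_eq]
  · simp
  · intro k hk
    have : J ≤ k := by
      by_contra hJ
      simp [hJ] at hk
    exact ⟨k - J, by simp [this]⟩

/-- If the coordinates of `θ` beyond level `J` are small, then so is the `ℓ²` distance of the
tails of `θ` and of a sequence `θ₀` with geometrically decaying blocks. -/
theorem tsum_block_sub_sq_le {θ θ₀ : ℕ+ → ℝ} {J : ℕ} {K r R : ℝ} (hJ : 1 ≤ J) (hr0 : 0 ≤ r)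
    (hr1 : r < 1) (hK : 0 ≤ K) (hR : 0 ≤ R) (hθ₀ : ∀ k, ∑ l, block θ₀ k l ^ 2 ≤ K * r ^ k)
    (hJR : 8 * K / (1 - r) * r ^ J ≤ R)
    (hθ : ∀ j, J ≤ level j → θ j ^ 2 ≤ R / (8 * 4 ^ level j)) :
    ∑' k, (if J ≤ k then ENNReal.ofReal (∑ l, (block θ k l - block θ₀ k l) ^ 2) else 0)
      ≤ ENNReal.ofReal (R / 2) := by
  -- Use `(x - y)² ≤ 2x² + 2y²`. Summed over `k ≥ J`, each of the two terms gives at most `R/4`: the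
  -- first because `J ≥ 1`, the second by `hJR`.
  have hblock : ∀ k, J ≤ k → ∑ l, (block θ k l - block θ₀ k l) ^ 2
      ≤ R / 4 * (1 / 2) ^ k + 2 * K * r ^ k := by
    intro k hk
    have h1 : ∑ l, block θ k l ^ 2 ≤ ∑ _l : Fin (2 ^ k), R / (8 * 4 ^ k) := by
      refine Finset.sum_le_sum fun l _ => ?_
      have := hθ (blockIndex k l) (by rwa [level_blockIndex])
      rwa [level_blockIndex] at this
    have h2 : ∑ _l : Fin (2 ^ k), R / (8 * 4 ^ k) = R / 8 * (1 / 2) ^ k := by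
      rw [Finset.sum_const, Finset.card_univ, Fintype.card_fin, nsmul_eq_mul]
      have : (4 : ℝ) ^ k = 2 ^ k * 2 ^ k := by rw [← mul_pow]; norm_num
      rw [this, one_div, inv_pow]
      push_cast
      field_simp
    calc _ ≤ ∑ l, (2 * block θ k l ^ 2 + 2 * block θ₀ k l ^ 2) :=
          Finset.sum_le_sum fun l _ => by nlinarith [sq_nonneg (block θ k l + block θ₀ k l)]
      _ = 2 * ∑ l, block θ k l ^ 2 + 2 * ∑ l, block θ₀ k l ^ 2 := by
          rw [Finset.sum_add_distrib, Finset.mul_sum, Finset.mul_sum]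
      _ ≤ _ := by linarith [hθ₀ k]
  rw [tsum_ite_le_eq_tsum_add]
  have hs1 : HasSum (fun i : ℕ => R / 4 * (1 / 2) ^ J * (1 / 2) ^ i) (R / 4 * (1 / 2) ^ J * 2) :=
    hasSum_geometric_two.mul_left _
  have hs2 : HasSum (fun i : ℕ => 2 * K * r ^ J * r ^ i) (2 * K * r ^ J * (1 - r)⁻¹) :=
    (hasSum_geometric_of_lt_one hr0 hr1).mul_left _
  have hs := hs1.add hs2
  calc _ ≤ ∑' i : ℕ, ENNReal.ofReal (R / 4 * (1 / 2) ^ J * (1 / 2) ^ i + 2 * K * r ^ J * r ^ i) := by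
        refine ENNReal.tsum_le_tsum fun i => ENNReal.ofReal_le_ofReal ?_
        refine (hblock _ (Nat.le_add_left _ _)).trans (le_of_eq ?_)
        rw [pow_add, pow_add]
        ring
    _ = ENNReal.ofReal (R / 4 * (1 / 2) ^ J * 2 + 2 * K * r ^ J * (1 - r)⁻¹) := by
        rw [← ENNReal.ofReal_tsum_of_nonneg (fun i => by positivity) hs.summable, hs.tsum_eq]
    _ ≤ _ := by
        refine ENNReal.ofReal_le_ofReal ?_
        have h1 : ((1 : ℝ) / 2) ^ J ≤ 1 / 2 := pow_le_of_le_one (by norm_num) (by norm_num) (by omega)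
        have h2 : 2 * K * r ^ J * (1 - r)⁻¹ = 8 * K / (1 - r) * r ^ J / 4 := by ring
        rw [h2]
        nlinarith

/-! ### High levels under the prior -/

theorem exp_neg_le_two_rpow_neg {y : ℝ} (hy : 0 ≤ y) : Real.exp (-y) ≤ (2 : ℝ) ^ (-y) := by
  rw [Real.rpow_def_of_pos two_pos]
  gcongr
  nlinarith [Real.log_two_lt_d9]

theorem two_rpow_neg_le_exp_neg {y : ℝ} (hy : 0 ≤ y) : (2 : ℝ) ^ (-(2 * y)) ≤ Real.exp (-y) := by
  rw [Real.rpow_def_of_pos two_pos]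
  gcongr
  nlinarith [Real.log_two_gt_d9]

/-- The Gaussian exponent is at least `2^k` as soon as `2^{3k + 4 - k²} ≤ R`; the lower bound on `k`
makes the left side at most `2^{-2αk}`. -/
theorem gaussianReal_high_level_le {α R : ℝ} {k : ℕ} (hα : 0 < α) (hk : 7 + 2 * α ≤ k)
    (hR : (2 : ℝ) ^ (-(2 * α) * k) ≤ R) {a : ℝ} (ha : a ≤ (2 : ℝ) ^ (-(k : ℝ) ^ 2)) :
    gaussianReal 0 a.toNNReal {x | R / (8 * 4 ^ k) < x ^ 2}
      ≤ ENNReal.ofReal (2 * (2 : ℝ) ^ (-(2 : ℝ) ^ (k : ℝ))) := by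
  have hR0 : 0 < R := lt_of_lt_of_le (by positivity) hR
  have h := gaussianReal_lt_sq_le (Real.toNNReal_le_toNNReal ha) (y := R / (8 * 4 ^ k))
    (by positivity)
  refine h.trans (ENNReal.ofReal_le_ofReal ?_)
  rw [Real.coe_toNNReal _ (by positivity)]
  gcongr
  rw [neg_div]
  refine le_trans ?_ (exp_neg_le_two_rpow_neg (y := (2 : ℝ) ^ (k : ℝ)) (by positivity))
  rw [Real.exp_le_exp, neg_le_neg_iff, div_div, le_div_iff₀ (by positivity)]
  refine le_trans ?_ hR
  have h4 : (4 : ℝ) ^ k = (2 : ℝ) ^ (2 * (k : ℝ)) := by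
    rw [Real.rpow_mul two_pos.le, Real.rpow_natCast]
    norm_num
  have h16 : (8 : ℝ) * 2 = (2 : ℝ) ^ (4 : ℝ) := by norm_num
  calc (2 : ℝ) ^ (k : ℝ) * (8 * 4 ^ k * (2 * (2 : ℝ) ^ (-(k : ℝ) ^ 2)))
      = (2 : ℝ) ^ (k : ℝ) * ((8 * 2) * (4 ^ k * (2 : ℝ) ^ (-(k : ℝ) ^ 2))) := by ring
    _ = (2 : ℝ) ^ ((k : ℝ) + (4 + (2 * k + -(k : ℝ) ^ 2))) := by
      rw [h4, h16, ← Real.rpow_add two_pos, ← Real.rpow_add two_pos, ← Real.rpow_add two_pos]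
    _ ≤ _ := by
      apply Real.rpow_le_rpow_of_exponent_le one_le_two
      nlinarith

theorem four_mul_add_four_le_two_pow {k : ℕ} (hk : 5 ≤ k) : 4 * k + 4 ≤ 2 ^ k := by
  induction k, hk using Nat.le_induction with
  | base => norm_num
  | succ k hk ih => rw [pow_succ]; omega

/-- The factor 3 counts one `2^{-2^k}` for the scale and two for the Gaussian deviation. Half of the
exponent `2^k` absorbs this factor, the block size and a geometric weight `2^{-k}`; the other half
is at least `2^J/2`. -/
theorem tsum_high_level_le {J : ℕ} (hJ : 5 ≤ J) :
    ∑' k, (if J ≤ k then ∑ _l : Fin (2 ^ k), ENNReal.ofReal (3 * (2 : ℝ) ^ (-(2 : ℝ) ^ (k : ℝ)))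
      else 0) ≤ ENNReal.ofReal (2 * (2 : ℝ) ^ (-((2 : ℝ) ^ J / 2))) := by
  have hs : HasSum (fun k : ℕ => (2 : ℝ) ^ (-((2 : ℝ) ^ J / 2)) * (1 / 2) ^ k)
      ((2 : ℝ) ^ (-((2 : ℝ) ^ J / 2)) * 2) := hasSum_geometric_two.mul_left _
  rw [mul_comm 2, ← hs.tsum_eq, ENNReal.ofReal_tsum_of_nonneg (fun k => by positivity) hs.summable]
  refine ENNReal.tsum_le_tsum fun k => ?_
  split_ifs with hk
  · rw [Finset.sum_const, Finset.card_univ, Fintype.card_fin, nsmul_eq_mul,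
      ← ENNReal.ofReal_natCast, ← ENNReal.ofReal_mul (by positivity)]
    refine ENNReal.ofReal_le_ofReal ?_
    have h1 : (2 : ℝ) ^ J ≤ 2 ^ k := pow_le_pow_right₀ one_le_two hk
    have h2 : 4 * (k : ℝ) + 4 ≤ 2 ^ k := by
      exact_mod_cast four_mul_add_four_le_two_pow (hJ.trans hk)
    have h3 : ((1 : ℝ) / 2) ^ k = (2 : ℝ) ^ (-(k : ℝ)) := by
      rw [Real.rpow_neg two_pos.le, Real.rpow_natCast, one_div, inv_pow]
    have h4 : ((2 : ℝ) ^ (2 : ℝ)) = 4 := by norm_num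
    push_cast
    rw [h3, ← Real.rpow_add two_pos]
    calc (2 : ℝ) ^ k * (3 * (2 : ℝ) ^ (-(2 : ℝ) ^ (k : ℝ)))
        ≤ (2 : ℝ) ^ k * ((2 : ℝ) ^ (2 : ℝ) * (2 : ℝ) ^ (-(2 : ℝ) ^ (k : ℝ))) := by
          rw [h4]
          gcongr
          norm_num
      _ = (2 : ℝ) ^ ((k : ℝ) + (2 + -(2 : ℝ) ^ k)) := by
          rw [Real.rpow_add two_pos (k : ℝ), Real.rpow_add two_pos (2 : ℝ), Real.rpow_natCast]
      _ ≤ _ := by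
          apply Real.rpow_le_rpow_of_exponent_le one_le_two
          linarith
  · exact zero_le

/-- Some coordinate beyond level `J` is large. -/
def largeTail (J : ℕ) (R : ℝ) : Set (ℕ+ → ℝ) :=
  {θ | ∃ j, J ≤ level j ∧ R / (8 * 4 ^ level j) < θ j ^ 2}

theorem two_rpow_mul_le_of_le {α R : ℝ} {J k : ℕ} (hα : 0 < α)
    (hR : (2 : ℝ) ^ (-(2 * α) * J) ≤ R) (hk : J ≤ k) : (2 : ℝ) ^ (-(2 * α) * k) ≤ R := by
  refine le_trans (Real.rpow_le_rpow_of_exponent_le one_le_two ?_) hR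
  have : (J : ℝ) ≤ k := by exact_mod_cast hk
  nlinarith

theorem measurableSet_lt_sq (y : ℝ) : MeasurableSet {x : ℝ | y < x ^ 2} :=
  measurableSet_lt measurable_const (by fun_prop)

theorem prior_largeTail_le {α R : ℝ} {J : ℕ} (hα : 0 < α) (hJ : 7 + 2 * α ≤ J)
    (hR : (2 : ℝ) ^ (-(2 * α) * J) ≤ R) :
    prior (largeTail J R) ≤ ENNReal.ofReal (2 * (2 : ℝ) ^ (-((2 : ℝ) ^ J / 2))) := by
  have hJ5 : 5 ≤ J := by
    have : (5 : ℝ) ≤ J := by linarith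
    exact_mod_cast this
  have hsub : largeTail J R ⊆ ⋃ j : ℕ+, (if J ≤ level j then
      (fun θ : ℕ+ → ℝ => θ j) ⁻¹' {x | R / (8 * 4 ^ level j) < x ^ 2} else ∅) := by
    rintro θ ⟨j, hj, hθ⟩
    refine Set.mem_iUnion.2 ⟨j, ?_⟩
    rw [if_pos hj]
    exact hθ
  refine (measure_mono hsub).trans ((measure_iUnion_le _).trans (le_trans ?_
    (tsum_high_level_le hJ5)))
  rw [tsum_eq_tsum_block]
  refine ENNReal.tsum_le_tsum fun k => ?_
  simp only [level_blockIndex]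
  split_ifs with hk
  · refine Finset.sum_le_sum fun l _ => ?_
    refine (prior_coord_le (blockIndex k l) (measurableSet_lt_sq _) measurableSet_Ioi
      (B := Set.Ioi ((2 : ℝ) ^ (-(k : ℝ) ^ 2))) fun a ha => gaussianReal_high_level_le hα
        (hJ.trans (by exact_mod_cast hk)) (two_rpow_mul_le_of_le hα hR hk) (not_lt.1 ha)).trans ?_
    rw [level_blockIndex]
    refine (add_le_add_left (mixLaw_Ioi_le k) _).trans ?_
    rw [← ENNReal.ofReal_add (by positivity) (by positivity)]
    exact ENNReal.ofReal_le_ofReal (by linarith)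
  · simp

/-! ### Low levels under the prior -/

/-- The interval radius over the standard deviation is about `2^{-(2α+1)(J-k)/2}`. Additive
constants in the exponent are absorbed using `J - k ≥ 1`. -/
theorem le_gaussianReal_low_level {α μ a : ℝ} {J k : ℕ} (hα : 0 < α) (hk : k < J)
    (ha1 : (2 : ℝ) ^ (-((2 * α + 1) * k)) / 2 ≤ a) (ha2 : a ≤ (2 : ℝ) ^ (-((2 * α + 1) * k))) :
    ENNReal.ofReal ((2 : ℝ) ^ (-((2 * α + 4) * (J - k) + 4 * μ ^ 2 * (2 : ℝ) ^ ((2 * α + 1) * k))))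
      ≤ gaussianReal 0 a.toNNReal {x | (x - μ) ^ 2 ≤ (2 : ℝ) ^ (-((2 * α + 1) * J + 1))} := by
  set b := (2 : ℝ) ^ (-((2 * α + 1) * k)) with hb
  set η := (2 : ℝ) ^ (-((2 * α + 1) * J + 1)) with hη
  have hb0 : 0 < b := by positivity
  have hη0 : 0 < η := by positivity
  have hJk : (k : ℝ) + 1 ≤ J := by exact_mod_cast hk
  refine le_trans (ENNReal.ofReal_le_ofReal ?_) (le_gaussianReal_sq_sub_le hb0 ha1 ha2 hη0.le)
  have hbinv : b⁻¹ = (2 : ℝ) ^ ((2 * α + 1) * k) := by rw [hb, Real.rpow_neg two_pos.le, inv_inv]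
  have hratio : η / b = (2 : ℝ) ^ (-((2 * α + 1) * (J - k) + 1)) := by
    rw [hη, hb, ← Real.rpow_sub two_pos]
    congr 1
    ring
  have hratio' : 2 * η / b ≤ 1 := by
    rw [mul_div_assoc, hratio]
    calc 2 * (2 : ℝ) ^ (-((2 * α + 1) * (J - k) + 1)) ≤ 2 * (2 : ℝ) ^ (-(1 : ℝ)) := by
          gcongr
          · norm_num
          · nlinarith
      _ = 1 := by rw [Real.rpow_neg two_pos.le]; norm_num
  -- After squaring, this is `η/(2b) ≤ 4η/(2πb)`, that is, `π ≤ 4`.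
  have hmass : (2 : ℝ) ^ (-((2 * α + 1) * (J - k) + 2) / 2)
      ≤ 2 * √η * (√(2 * Real.pi * b))⁻¹ := by
    have e : (2 : ℝ) ^ (-((2 * α + 1) * (J - k) + 2) / 2) = √(η / (2 * b)) := by
      have half : η / (2 * b) = (2 : ℝ) ^ (-((2 * α + 1) * (J - k) + 1) - 1) := by
        rw [mul_comm 2 b, ← div_div, hratio, Real.rpow_sub two_pos, Real.rpow_one]
      rw [Real.sqrt_eq_rpow, half, ← Real.rpow_mul two_pos.le]
      congr 1
      ring
    have e2 : 2 * √η * (√(2 * Real.pi * b))⁻¹ = √(4 * η / (2 * Real.pi * b)) := by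
      rw [Real.sqrt_div (by positivity), Real.sqrt_mul (by norm_num : (0 : ℝ) ≤ 4),
        show (4 : ℝ) = 2 ^ 2 by norm_num, Real.sqrt_sq two_pos.le, div_eq_mul_inv]
    rw [e, e2]
    apply Real.sqrt_le_sqrt
    rw [div_le_div_iff₀ (by positivity) (by positivity)]
    have := Real.pi_lt_d2
    nlinarith [mul_pos hη0 hb0]
  have hexp : (2 : ℝ) ^ (-(4 * μ ^ 2 * (2 : ℝ) ^ ((2 * α + 1) * k) + 2))
      ≤ Real.exp (-(2 * (μ ^ 2 + η) / b)) := by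
    refine le_trans ?_ (two_rpow_neg_le_exp_neg (by positivity))
    apply Real.rpow_le_rpow_of_exponent_le one_le_two
    rw [← hbinv]
    have : 2 * (2 * (μ ^ 2 + η) / b) = 4 * μ ^ 2 * b⁻¹ + 2 * (2 * η / b) := by ring
    linarith
  calc _ ≤ (2 : ℝ) ^ (-((2 * α + 1) * (J - k) + 2) / 2)
        * (2 : ℝ) ^ (-(4 * μ ^ 2 * (2 : ℝ) ^ ((2 * α + 1) * k) + 2)) := by
        rw [← Real.rpow_add two_pos]
        apply Real.rpow_le_rpow_of_exponent_le one_le_two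
        nlinarith
    _ ≤ (2 * √η * (√(2 * Real.pi * b))⁻¹) * Real.exp (-(2 * (μ ^ 2 + η) / b)) := by gcongr
    _ = _ := by ring

theorem le_mixLaw_low_level {α : ℝ} (hα : 0 < α) (k : ℕ) :
    ENNReal.ofReal ((2 : ℝ) ^ (-((2 * α + 3) * 2 ^ k))) ≤ mixLaw k
      (Set.Icc ((2 : ℝ) ^ (-((2 * α + 1) * k)) / 2) ((2 : ℝ) ^ (-((2 * α + 1) * k)))) := by
  have hk0 : (0 : ℝ) ≤ k := by positivity
  have hk : (k : ℝ) ≤ 2 ^ k := by exact_mod_cast Nat.lt_two_pow_self.le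
  have hk1 : (1 : ℝ) ≤ 2 ^ k := one_le_pow₀ one_le_two
  refine le_trans (ENNReal.ofReal_le_ofReal ?_) (le_mixLaw_Icc (by positivity)
    (Real.rpow_le_rpow_of_exponent_le one_le_two (by nlinarith)))
  have e : (2 : ℝ) ^ (-((2 * α + 1) * k)) - (2 : ℝ) ^ (-((2 * α + 1) * k)) / 2
      = (2 : ℝ) ^ (-((2 * α + 1) * k) - 1) := by
    rw [Real.rpow_sub two_pos, Real.rpow_one]
    ring
  rw [e, ← Real.rpow_add two_pos, Real.rpow_natCast]
  apply Real.rpow_le_rpow_of_exponent_le one_le_two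
  nlinarith

theorem sum_range_two_pow (J : ℕ) : ∑ k ∈ Finset.range J, (2 : ℝ) ^ k ≤ 2 ^ J := by
  rw [geom_sum_eq (by norm_num)]
  norm_num

/-- This avoids a logarithmic loss: the low-level cost `J - k` per coordinate adds up to `O(2^J)`,
not `O(J 2^J)`. -/
theorem sum_range_two_pow_mul (J : ℕ) :
    ∑ k ∈ Finset.range J, (2 : ℝ) ^ k * ((J : ℝ) - k) ≤ 2 * 2 ^ J := by
  induction J with
  | zero => simp
  | succ J ih =>
    have e : ∑ k ∈ Finset.range (J + 1), (2 : ℝ) ^ k * (((J + 1 : ℕ) : ℝ) - k)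
        = ∑ k ∈ Finset.range J, (2 : ℝ) ^ k * ((J : ℝ) - k)
          + ∑ k ∈ Finset.range (J + 1), (2 : ℝ) ^ k := by
      rw [Finset.sum_range_succ, Finset.sum_range_succ, ← add_assoc, ← Finset.sum_add_distrib]
      congr 1
      · refine Finset.sum_congr rfl fun k _ => ?_
        push_cast
        ring
      · push_cast
        ring
    rw [e, geom_sum_eq (by norm_num)]
    rw [pow_succ]
    linarith

/-- The coordinates of the levels below `J`. -/
noncomputable def lowLevels (J : ℕ) : Finset ℕ+ :=
  ((Finset.range J).sigma fun _ => Finset.univ).map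
    (Equiv.ofBijective _ bijective_blockIndex).toEmbedding

theorem mem_lowLevels {J : ℕ} {j : ℕ+} : j ∈ lowLevels J ↔ level j < J := by
  obtain ⟨⟨k, l⟩, rfl⟩ := bijective_blockIndex.2 j
  simp only [level_blockIndex, lowLevels, Finset.mem_map_equiv]
  rw [show blockIndex k l = Equiv.ofBijective _ bijective_blockIndex ⟨k, l⟩ from rfl,
    Equiv.symm_apply_apply]
  simp

theorem prod_lowLevels (J : ℕ) (f : ℕ+ → ℝ≥0∞) :
    ∏ j ∈ lowLevels J, f j = ∏ k ∈ Finset.range J, ∏ l, f (blockIndex k l) := by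
  rw [lowLevels, Finset.prod_map, Finset.prod_sigma]
  rfl

theorem high_level_le_half {J : ℕ} (hJ : 5 ≤ J) :
    ENNReal.ofReal (2 * (2 : ℝ) ^ (-((2 : ℝ) ^ J / 2))) ≤ ENNReal.ofReal (1 / 2) := by
  refine ENNReal.ofReal_le_ofReal ?_
  have h : (4 : ℝ) * J + 4 ≤ 2 ^ J := by exact_mod_cast four_mul_add_four_le_two_pow hJ
  have hJ' : (0 : ℝ) ≤ J := by positivity
  calc 2 * (2 : ℝ) ^ (-((2 : ℝ) ^ J / 2)) ≤ 2 * (2 : ℝ) ^ (-(2 : ℝ)) := by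
        gcongr
        · norm_num
        · linarith
    _ = 1 / 2 := by rw [Real.rpow_neg two_pos.le]; norm_num

theorem one_sub_ofReal_half : (1 : ℝ≥0∞) - ENNReal.ofReal (1 / 2) = ENNReal.ofReal (2 ^ (-1 : ℝ)) := by
  rw [← ENNReal.ofReal_one, ← ENNReal.ofReal_sub _ (by norm_num), Real.rpow_neg_one]
  norm_num

theorem prod_ofReal_two_rpow {ι : Type*} (s : Finset ι) (f : ι → ℝ) :
    ∏ i ∈ s, ENNReal.ofReal ((2 : ℝ) ^ (f i)) = ENNReal.ofReal ((2 : ℝ) ^ (∑ i ∈ s, f i)) := by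
  rw [Real.rpow_sum_of_pos two_pos, ENNReal.ofReal_prod_of_nonneg fun i _ => by positivity]

/-- The box for the scales used in the small ball estimate. -/
def scaleBox (α : ℝ) (J k : ℕ) : Set ℝ :=
  if k < J then
    Set.Icc ((2 : ℝ) ^ (-((2 * α + 1) * k)) / 2) ((2 : ℝ) ^ (-((2 * α + 1) * k)))
  else Set.Iic ((2 : ℝ) ^ (-(k : ℝ) ^ 2))

/-- The box for the coordinates used in the small ball estimate. -/
def coordBox (α R : ℝ) (θ₀ : ℕ+ → ℝ) (J : ℕ) (j : ℕ+) : Set ℝ :=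
  if level j < J then {x | (x - θ₀ j) ^ 2 ≤ (2 : ℝ) ^ (-((2 * α + 1) * J + 1))}
  else {x | x ^ 2 ≤ R / (8 * 4 ^ level j)}

theorem measurableSet_scaleBox (α : ℝ) (J k : ℕ) : MeasurableSet (scaleBox α J k) := by
  unfold scaleBox
  split_ifs
  · exact measurableSet_Icc
  · exact measurableSet_Iic

theorem measurableSet_coordBox (α R : ℝ) (θ₀ : ℕ+ → ℝ) (J : ℕ) (j : ℕ+) :
    MeasurableSet (coordBox α R θ₀ J j) := by
  unfold coordBox
  split_ifs
  · exact measurableSet_le (by fun_prop) measurable_const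
  · exact measurableSet_le (by fun_prop) measurable_const

theorem le_infinitePi_scaleBox {α : ℝ} {J : ℕ} (hα : 0 < α) (hJ : 5 ≤ J) :
    ENNReal.ofReal ((2 : ℝ) ^ (-((2 * α + 3) * 2 ^ J) - 1))
      ≤ Measure.infinitePi mixLaw (Set.univ.pi (scaleBox α J)) := by
  -- The majorant carries a superfluous factor `3·2^k`, so that the bound made for the coordinates
  -- also serves for the scales.
  refine le_trans ?_ (prod_mul_one_sub_le_infinitePi mixLaw (measurableSet_scaleBox α J)
    (Finset.range J) (fun k => if J ≤ k then
      ∑ _l : Fin (2 ^ k), ENNReal.ofReal (3 * (2 : ℝ) ^ (-(2 : ℝ) ^ (k : ℝ))) else 0)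
    (fun k hk => ?_) ((tsum_high_level_le hJ).trans (high_level_le_half hJ)))
  · rw [one_sub_ofReal_half]
    calc _ ≤ ENNReal.ofReal ((2 : ℝ) ^ (∑ k ∈ Finset.range J, -((2 * α + 3) * 2 ^ k)))
          * ENNReal.ofReal (2 ^ (-1 : ℝ)) := by
          rw [← ENNReal.ofReal_mul (by positivity), ← Real.rpow_add two_pos,
            Finset.sum_neg_distrib, ← Finset.mul_sum]
          refine ENNReal.ofReal_le_ofReal (Real.rpow_le_rpow_of_exponent_le one_le_two ?_)
          nlinarith [sum_range_two_pow J]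
      _ ≤ _ := by
          gcongr
          rw [← prod_ofReal_two_rpow]
          refine Finset.prod_le_prod' fun k hk => ?_
          rw [scaleBox, if_pos (Finset.mem_range.1 hk)]
          exact le_mixLaw_low_level hα k
  · have hJk : J ≤ k := by simpa using hk
    rw [if_pos hJk, scaleBox, if_neg (by omega), Set.compl_Iic]
    refine (mixLaw_Ioi_le k).trans ?_
    have h0 : (0 : ℝ) ≤ (2 : ℝ) ^ (-(2 : ℝ) ^ (k : ℝ)) := by positivity
    calc _ ≤ ENNReal.ofReal (3 * (2 : ℝ) ^ (-(2 : ℝ) ^ (k : ℝ))) :=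
          ENNReal.ofReal_le_ofReal (by linarith)
      _ ≤ _ := Finset.single_le_sum (f := fun _ : Fin (2 ^ k) =>
          ENNReal.ofReal (3 * (2 : ℝ) ^ (-(2 : ℝ) ^ (k : ℝ)))) (fun _ _ => zero_le)
          (Finset.mem_univ ⟨0, by positivity⟩)

theorem le_gaussianBlocks_coordBox {α Q R : ℝ} {θ₀ : ℕ+ → ℝ} {J : ℕ} (hα : 0 < α)
    (hθ₀ : ∀ k, ∑ l, block θ₀ k l ^ 2 ≤ Q ^ 2 * ((2 : ℝ) ^ (-(2 * α))) ^ k)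
    (hJ : 7 + 2 * α ≤ J) (hR : (2 : ℝ) ^ (-(2 * α) * J) ≤ R) {A : ℕ → ℝ}
    (hA : A ∈ Set.univ.pi (scaleBox α J)) :
    ENNReal.ofReal ((2 : ℝ) ^ (-((4 * α + 8 + 4 * Q ^ 2) * 2 ^ J) - 1))
      ≤ gaussianBlocks A (Set.univ.pi (coordBox α R θ₀ J)) := by
  have hJ5 : 5 ≤ J := by
    have : (5 : ℝ) ≤ J := by linarith
    exact_mod_cast this
  refine le_trans ?_ (prod_mul_one_sub_le_infinitePi _ (measurableSet_coordBox α R θ₀ J)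
    (lowLevels J) (fun j => if J ≤ level j then
      ENNReal.ofReal (3 * (2 : ℝ) ^ (-(2 : ℝ) ^ (level j : ℝ))) else 0)
    (fun j hj => ?_) (le_trans (le_of_eq ?_)
      ((tsum_high_level_le hJ5).trans (high_level_le_half hJ5))))
  · rw [one_sub_ofReal_half, prod_lowLevels]
    calc _ ≤ ENNReal.ofReal ((2 : ℝ) ^ (∑ k ∈ Finset.range J, ∑ l : Fin (2 ^ k),
            -((2 * α + 4) * (J - k) + 4 * block θ₀ k l ^ 2 * (2 : ℝ) ^ ((2 * α + 1) * k))))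
          * ENNReal.ofReal (2 ^ (-1 : ℝ)) := by
          rw [← ENNReal.ofReal_mul (by positivity), ← Real.rpow_add two_pos]
          refine ENNReal.ofReal_le_ofReal (Real.rpow_le_rpow_of_exponent_le one_le_two ?_)
          have hk : ∀ k ∈ Finset.range J, ∑ l : Fin (2 ^ k),
              ((2 * α + 4) * ((J : ℝ) - k) + 4 * block θ₀ k l ^ 2 * (2 : ℝ) ^ ((2 * α + 1) * k))
              ≤ (2 * α + 4) * (2 ^ k * ((J : ℝ) - k)) + 4 * Q ^ 2 * 2 ^ k := by
            intro k _
            rw [Finset.sum_add_distrib, Finset.sum_const, Finset.card_univ, Fintype.card_fin,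
              nsmul_eq_mul, ← Finset.sum_mul, ← Finset.mul_sum]
            -- The decay of the block of `θ₀` offsets the inverse scale, up to the block size.
            have e : ((2 : ℝ) ^ (-(2 * α))) ^ k * (2 : ℝ) ^ ((2 * α + 1) * k) = 2 ^ k := by
              rw [← Real.rpow_mul_natCast two_pos.le, ← Real.rpow_add two_pos, ← Real.rpow_natCast]
              congr 1
              ring
            have h := mul_le_mul_of_nonneg_right (hθ₀ k)
              (show (0 : ℝ) ≤ (2 : ℝ) ^ ((2 * α + 1) * k) by positivity)
            rw [mul_assoc, e] at h
            push_cast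
            nlinarith
          have hsum := Finset.sum_le_sum hk
          rw [Finset.sum_add_distrib, ← Finset.mul_sum, ← Finset.mul_sum] at hsum
          simp only [Finset.sum_neg_distrib]
          have h1 := sum_range_two_pow J
          have h2 := sum_range_two_pow_mul J
          have h3 : (2 * α + 4) * ∑ k ∈ Finset.range J, (2 : ℝ) ^ k * ((J : ℝ) - k)
              ≤ (2 * α + 4) * (2 * 2 ^ J) := by gcongr
          have h4 : 4 * Q ^ 2 * ∑ k ∈ Finset.range J, (2 : ℝ) ^ k ≤ 4 * Q ^ 2 * 2 ^ J := by gcongr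
          linarith
      _ ≤ _ := by
          gcongr
          rw [← prod_ofReal_two_rpow]
          refine Finset.prod_le_prod' fun k hk => ?_
          rw [← prod_ofReal_two_rpow]
          refine Finset.prod_le_prod' fun l _ => ?_
          have hkJ : k < J := Finset.mem_range.1 hk
          have hAk := hA k (Set.mem_univ k)
          rw [scaleBox, if_pos hkJ] at hAk
          rw [coordBox, level_blockIndex, if_pos hkJ]
          exact le_gaussianReal_low_level hα hkJ hAk.1 hAk.2
  · have hj' : J ≤ level j := by simpa [mem_lowLevels] using hj
    have hAk := hA (level j) (Set.mem_univ _)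
    rw [scaleBox, if_neg (by omega)] at hAk
    rw [if_pos hj', coordBox, if_neg (by omega)]
    have hc : {x : ℝ | x ^ 2 ≤ R / (8 * 4 ^ level j)}ᶜ = {x | R / (8 * 4 ^ level j) < x ^ 2} := by
      ext x
      simp
    rw [hc]
    refine (gaussianReal_high_level_le hα (hJ.trans (by exact_mod_cast hj'))
      (two_rpow_mul_le_of_le hα hR hj') hAk).trans (ENNReal.ofReal_le_ofReal ?_)
    gcongr
    norm_num
  · rw [tsum_eq_tsum_block]
    refine tsum_congr fun k => ?_
    simp only [level_blockIndex]
    split_ifs <;> simp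

/-- The constant adds `4α + 8 + 4Q²` (coordinates), `2α + 3` (scales) and 2 for the two factors
`1/2` lost on high levels. -/
theorem le_prior_coordBox {α Q R : ℝ} {θ₀ : ℕ+ → ℝ} {J : ℕ} (hα : 0 < α)
    (hθ₀ : ∀ k, ∑ l, block θ₀ k l ^ 2 ≤ Q ^ 2 * ((2 : ℝ) ^ (-(2 * α))) ^ k)
    (hJ : 7 + 2 * α ≤ J) (hR : (2 : ℝ) ^ (-(2 * α) * J) ≤ R) :
    ENNReal.ofReal ((2 : ℝ) ^ (-((6 * α + 13 + 4 * Q ^ 2) * 2 ^ J)))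
      ≤ prior (Set.univ.pi (coordBox α R θ₀ J)) := by
  have hJ5 : 5 ≤ J := by
    have : (5 : ℝ) ≤ J := by linarith
    exact_mod_cast this
  refine le_trans ?_ (mul_le_prior
    (MeasurableSet.univ_pi fun j => measurableSet_coordBox α R θ₀ J j)
    (MeasurableSet.univ_pi fun k => measurableSet_scaleBox α J k)
    fun A hA => le_gaussianBlocks_coordBox hα hθ₀ hJ hR hA)
  refine le_trans ?_ (mul_le_mul_right (le_infinitePi_scaleBox hα hJ5) _)
  rw [← ENNReal.ofReal_mul (by positivity), ← Real.rpow_add two_pos]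
  refine ENNReal.ofReal_le_ofReal (Real.rpow_le_rpow_of_exponent_le one_le_two ?_)
  have h1 : (1 : ℝ) ≤ 2 ^ J := one_le_pow₀ one_le_two
  linarith

/-! ### The two events -/

theorem coordBox_subset_l2Ball {α Q : ℝ} {θ₀ : ℕ+ → ℝ} {J n : ℕ} (hα : 0 < α) (hJ : 1 ≤ J)
    (hθ₀ : ∀ k, ∑ l, block θ₀ k l ^ 2 ≤ Q ^ 2 * ((2 : ℝ) ^ (-(2 * α))) ^ k)
    (hR : (2 : ℝ) ^ (-(2 * α) * J) ≤ rateSq α n)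
    (hJR : 8 * Q ^ 2 / (1 - (2 : ℝ) ^ (-(2 * α))) * ((2 : ℝ) ^ (-(2 * α))) ^ J ≤ rateSq α n) :
    Set.univ.pi (coordBox α (rateSq α n) θ₀ J) ⊆ l2Ball α θ₀ n := by
  intro θ hθ
  have hR0 : 0 ≤ rateSq α n := le_trans (by positivity) hR
  have hr1 : (2 : ℝ) ^ (-(2 * α)) < 1 := Real.rpow_lt_one_of_one_lt_of_neg one_lt_two (by linarith)
  have htail := tsum_block_sub_sq_le (θ := θ) hJ (by positivity) hr1 (by positivity) hR0 hθ₀ hJR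
    (fun j hj => by
      have h := hθ j (Set.mem_univ j)
      rwa [coordBox, if_neg (by omega)] at h)
  have hhead : ∑ k ∈ Finset.range J,
      ENNReal.ofReal (∑ l, (block θ k l - block θ₀ k l) ^ 2) ≤ ENNReal.ofReal (rateSq α n / 2) := by
    rw [← ENNReal.ofReal_sum_of_nonneg fun k _ => Finset.sum_nonneg fun l _ => sq_nonneg _]
    refine ENNReal.ofReal_le_ofReal ?_
    calc _ ≤ ∑ k ∈ Finset.range J, (2 : ℝ) ^ k * (2 : ℝ) ^ (-((2 * α + 1) * J + 1)) := by
          refine Finset.sum_le_sum fun k hk => ?_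
          have h : ∀ l ∈ Finset.univ, (block θ k l - block θ₀ k l) ^ 2
              ≤ (2 : ℝ) ^ (-((2 * α + 1) * J + 1)) := by
            intro l _
            have h := hθ (blockIndex k l) (Set.mem_univ _)
            rwa [coordBox, level_blockIndex, if_pos (Finset.mem_range.1 hk)] at h
          refine (Finset.sum_le_sum h).trans (le_of_eq ?_)
          rw [Finset.sum_const, Finset.card_univ, Fintype.card_fin, nsmul_eq_mul]
          push_cast
          rfl
      _ ≤ (2 : ℝ) ^ J * (2 : ℝ) ^ (-((2 * α + 1) * J + 1)) := by
          rw [← Finset.sum_mul]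
          gcongr
          exact sum_range_two_pow J
      _ = (2 : ℝ) ^ (-(2 * α) * J) / 2 := by
          rw [← Real.rpow_natCast, ← Real.rpow_add two_pos,
            show (J : ℝ) + -((2 * α + 1) * J + 1) = -(2 * α) * J - 1 by ring,
            Real.rpow_sub two_pos, Real.rpow_one]
      _ ≤ _ := by linarith
  change ∑' j, ENNReal.ofReal ((θ j - θ₀ j) ^ 2) ≤ _
  have hsplit : ∑' k, ENNReal.ofReal (∑ l, (block θ k l - block θ₀ k l) ^ 2)
      = ∑ k ∈ Finset.range J, ENNReal.ofReal (∑ l, (block θ k l - block θ₀ k l) ^ 2)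
        + ∑' k, (if J ≤ k then
            ENNReal.ofReal (∑ l, (block θ k l - block θ₀ k l) ^ 2) else 0) := by
    rw [tsum_ite_le_eq_tsum_add]
    exact (ENNReal.summable.sum_add_tsum_nat_add' (k := J)).symm
  calc _ = ∑' k, ENNReal.ofReal (∑ l, (block θ k l - block θ₀ k l) ^ 2) := by
        rw [tsum_eq_tsum_block]
        refine tsum_congr fun k => ?_
        rw [ENNReal.ofReal_sum_of_nonneg fun l _ => sq_nonneg _]
        rfl
    _ ≤ ENNReal.ofReal (rateSq α n / 2) + ENNReal.ofReal (rateSq α n / 2) := by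
        rw [hsplit]
        exact add_le_add hhead htail
    _ = _ := by rw [← ENNReal.ofReal_add (by positivity) (by positivity), add_halves]

theorem compl_sieve_subset_largeTail {α β Q : ℝ} {θ₀ : ℕ+ → ℝ} {J n : ℕ} (hα : 0 < α)
    (hJ : 1 ≤ J) (hθ₀ : ∀ k, ∑ l, block θ₀ k l ^ 2 ≤ Q ^ 2 * ((2 : ℝ) ^ (-(2 * α))) ^ k)
    (hR0 : 0 ≤ rateSq α n)
    (hJR : 8 * Q ^ 2 / (1 - (2 : ℝ) ^ (-(2 * α))) * ((2 : ℝ) ^ (-(2 * α))) ^ J ≤ rateSq α n)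
    (hJk : ∀ k : ℕ, (2 * α + 1)⁻¹ * Real.logb 2 (n * β⁻¹) < k → J ≤ k) :
    (sieve α β θ₀ n)ᶜ ⊆ largeTail J (rateSq α n) := by
  intro θ hθ
  by_contra hL
  have hsmall : ∀ j, J ≤ level j → θ j ^ 2 ≤ rateSq α n / (8 * 4 ^ level j) := by
    intro j hj
    by_contra h
    exact hL ⟨j, hj, not_le.1 h⟩
  refine hθ ?_
  have hr1 : (2 : ℝ) ^ (-(2 * α)) < 1 := Real.rpow_lt_one_of_one_lt_of_neg one_lt_two (by linarith)
  have htail := tsum_block_sub_sq_le hJ (by positivity) hr1 (by positivity) hR0 hθ₀ hJR hsmall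
  change ∑' k : {k : ℕ | (2 * α + 1)⁻¹ * Real.logb 2 (n * β⁻¹) < k},
    ENNReal.ofReal (∑ l, (block θ k l - block θ₀ k l) ^ 2) ≤ _
  rw [tsum_subtype {k : ℕ | (2 * α + 1)⁻¹ * Real.logb 2 (n * β⁻¹) < k}
    fun k => ENNReal.ofReal (∑ l, (block θ k l - block θ₀ k l) ^ 2)]
  refine le_trans (ENNReal.tsum_le_tsum fun k => ?_)
    (htail.trans (ENNReal.ofReal_le_ofReal (by linarith)))
  rw [Set.indicator_apply]
  split_ifs with h1 h2 h2
  · exact le_rfl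
  · exact absurd (hJk k h1) h2
  · exact zero_le
  · exact le_rfl

/-! ### The rate -/

theorem natCast_mul_rateSq {α : ℝ} (hα : 0 < α) {n : ℕ} (hn : 0 < n) :
    (n : ℝ) * rateSq α n = (n : ℝ) ^ (2 * α + 1)⁻¹ := by
  have hn' : (0 : ℝ) < n := by exact_mod_cast hn
  rw [rateSq]
  nth_rw 1 [← Real.rpow_one (n : ℝ)]
  rw [← Real.rpow_add hn']
  congr 1
  field_simp
  ring

theorem rateSq_eq_rpow {α : ℝ} (hα : 0 < α) {n : ℕ} :
    rateSq α n = ((n : ℝ) ^ (2 * α + 1)⁻¹) ^ (-(2 * α)) := by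
  rw [rateSq, ← Real.rpow_mul (by positivity)]
  congr 1
  field_simp

theorem pow_level_le_rateSq {α D L : ℝ} (hα : 0 < α) (hD : 1 ≤ D) (hL : L ≤ D ^ (2 * α))
    {n J : ℕ} (hn : 0 < n) (hJ : D * (n : ℝ) ^ (2 * α + 1)⁻¹ ≤ 2 ^ J) :
    (2 : ℝ) ^ (-(2 * α) * J) ≤ rateSq α n ∧ L * ((2 : ℝ) ^ (-(2 * α))) ^ J ≤ rateSq α n := by
  have hn' : (0 : ℝ) < n := by exact_mod_cast hn
  have hD0 : 0 < D := by linarith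
  set N := (n : ℝ) ^ (2 * α + 1)⁻¹ with hN
  have hN0 : 0 < N := by positivity
  have e1 : (2 : ℝ) ^ (-(2 * α) * J) = ((2 : ℝ) ^ J) ^ (-(2 * α)) := by
    rw [mul_comm, Real.rpow_mul two_pos.le, Real.rpow_natCast]
  have h1 : (2 : ℝ) ^ (-(2 * α) * J) ≤ D ^ (-(2 * α)) * rateSq α n := by
    rw [e1, rateSq_eq_rpow hα, ← Real.mul_rpow hD0.le hN0.le]
    exact Real.rpow_le_rpow_of_nonpos (by positivity) hJ (by linarith)
  have hR0 : 0 ≤ rateSq α n := by rw [rateSq]; positivity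
  constructor
  · refine h1.trans (mul_le_of_le_one_left hR0 ?_)
    exact Real.rpow_le_one_of_one_le_of_nonpos hD (by linarith)
  · rw [← Real.rpow_mul_natCast two_pos.le]
    calc _ ≤ D ^ (2 * α) * (D ^ (-(2 * α)) * rateSq α n) := by gcongr
      _ = _ := by
        rw [← mul_assoc, ← Real.rpow_add hD0]
        simp

end BlockPrior

/-! ### Choice of the constants and of the two cut-off levels -/

theorem theorem5p2 (α Q : ℝ) (p q : ℝ≥0∞) (hα : 0 < α) (hp : 2 ≤ p) (hq : 1 ≤ q) (hQ : 0 < Q)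
    (θ₀ : ℕ+ → ℝ) (hθ₀ : θ₀ ∈ BlockPrior.besovBall α p q Q) :
    ∃ C : ℝ, 0 < C ∧ ∀ᶠ n : ℕ in atTop,
      ENNReal.ofReal ((2 : ℝ) ^ (-C * n * BlockPrior.rateSq α n))
          ≤ BlockPrior.prior (BlockPrior.l2Ball α θ₀ n) ∧
      ∀ c₃ : ℝ, 0 < c₃ → BlockPrior.MixTail c₃ →
        ∀ β : ℝ, 0 < β →
          β ≤ (min (c₃ / (2 * (C + 4))) ((4 * Q ^ 2) ^ (-2 * α))) ^ (2 * α + 1) →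
          BlockPrior.prior (BlockPrior.sieve α β θ₀ n)ᶜ
            ≤ ENNReal.ofReal ((2 : ℝ) ^ (1 - (C + 4) * n * BlockPrior.rateSq α n)) := by
  have hblocks := BlockPrior.sum_block_sq_le hp hq hQ hθ₀
  have hr1 : (2 : ℝ) ^ (-(2 * α)) < 1 := Real.rpow_lt_one_of_one_lt_of_neg one_lt_two (by linarith)
  set L := 8 * Q ^ 2 / (1 - (2 : ℝ) ^ (-(2 * α))) with hLdef
  have hL0 : 0 ≤ L := div_nonneg (by positivity) (by linarith)
  -- With this `D`, any `J` with `2^J ≥ D N` makes the tail of `θ₀` negligible: `L 2^{-2αJ} ≤ ε_n²`.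
  obtain ⟨D, hD1, hLD⟩ : ∃ D : ℝ, 1 ≤ D ∧ L ≤ D ^ (2 * α) := by
    refine ⟨max 1 (L ^ (2 * α)⁻¹), le_max_left _ _, ?_⟩
    calc L = (L ^ (2 * α)⁻¹) ^ (2 * α) := (Real.rpow_inv_rpow hL0 (by positivity)).symm
      _ ≤ _ := by
        gcongr
        exact le_max_right _ _
  -- The factor 2 pays for rounding `D N` up to a power of 2.
  set C := 2 * D * (6 * α + 13 + 4 * Q ^ 2) with hC
  have hCD : D ≤ C := by nlinarith [sq_nonneg Q]
  refine ⟨C, by linarith, ?_⟩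
  have hlim : Tendsto (fun n : ℕ => (n : ℝ) ^ (2 * α + 1)⁻¹) atTop atTop :=
    (tendsto_rpow_atTop (by positivity)).comp tendsto_natCast_atTop_atTop
  -- The threshold on `n` depends on `α` alone, hence is uniform in `c₃` and `β`.
  filter_upwards [hlim.eventually_ge_atTop ((2 : ℝ) ^ (7 + 2 * α)), eventually_gt_atTop 0]
    with n hn hn0
  have hn' : (0 : ℝ) < n := by exact_mod_cast hn0
  have hn1 : (1 : ℝ) ≤ n := by exact_mod_cast hn0
  have hNR := BlockPrior.natCast_mul_rateSq hα hn0
  rw [mul_assoc, hNR]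
  set N := (n : ℝ) ^ (2 * α + 1)⁻¹ with hN
  have hN0 : 0 < N := by positivity
  have hlevel : ∀ J : ℕ, D * N ≤ 2 ^ J → 7 + 2 * α ≤ J := by
    intro J hJ
    rw [← Real.rpow_le_rpow_left_iff one_lt_two, Real.rpow_natCast]
    nlinarith
  refine ⟨?_, fun c₃ hc₃ htail β hβ hβle => ?_⟩
  · have hDN : 1 ≤ D * N := by
      have : 1 ≤ N := Real.one_le_rpow hn1 (by positivity)
      nlinarith
    obtain ⟨m, hm1, hm2⟩ := exists_nat_pow_near hDN one_lt_two
    have hJ := hlevel (m + 1) hm2.le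
    obtain ⟨hR1, hR2⟩ := BlockPrior.pow_level_le_rateSq hα hD1 hLD hn0 hm2.le
    refine le_trans ?_ (measure_mono (BlockPrior.coordBox_subset_l2Ball hα (Nat.le_add_left 1 m)
      hblocks hR1 hR2))
    refine le_trans (ENNReal.ofReal_le_ofReal ?_) (BlockPrior.le_prior_coordBox hα hblocks hJ hR1)
    apply Real.rpow_le_rpow_of_exponent_le one_le_two
    rw [pow_succ (2 : ℝ) m]
    have : (6 * α + 13 + 4 * Q ^ 2) * (2 ^ m * 2) ≤ (6 * α + 13 + 4 * Q ^ 2) * (D * N * 2) := by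
      gcongr
    rw [hC]
    linarith
  · have hc1 := htail.le_one
    have hC4 : 0 < C + 4 := by linarith
    -- Since `c₃ ≤ 1`, the bound on `β` puts the sieve cut-off at `2^κ ≥ 2(C+4)N`.
    have hb : β ^ (2 * α + 1)⁻¹ ≤ 1 / (2 * (C + 4)) := by
      have hmin : 0 ≤ min (c₃ / (2 * (C + 4))) ((4 * Q ^ 2) ^ (-2 * α)) := by positivity
      calc _ ≤ ((min (c₃ / (2 * (C + 4))) ((4 * Q ^ 2) ^ (-2 * α))) ^ (2 * α + 1))
            ^ (2 * α + 1)⁻¹ := by gcongr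
        _ = min (c₃ / (2 * (C + 4))) ((4 * Q ^ 2) ^ (-2 * α)) :=
            Real.rpow_rpow_inv hmin (by positivity)
        _ ≤ c₃ / (2 * (C + 4)) := min_le_left _ _
        _ ≤ _ := by gcongr
    have hb0 : 0 < β ^ (2 * α + 1)⁻¹ := by positivity
    have hpow : (2 : ℝ) ^ ((2 * α + 1)⁻¹ * Real.logb 2 (n * β⁻¹)) = N / β ^ (2 * α + 1)⁻¹ := by
      rw [mul_comm, Real.rpow_mul two_pos.le, Real.rpow_logb two_pos (by norm_num) (by positivity),
        Real.mul_rpow hn'.le (by positivity), Real.inv_rpow hβ.le, div_eq_mul_inv]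
    have hbig : 2 * (C + 4) * N ≤ N / β ^ (2 * α + 1)⁻¹ := by
      rw [le_div_iff₀ hb0]
      rw [le_div_iff₀ (by positivity)] at hb
      nlinarith
    set κ := (2 * α + 1)⁻¹ * Real.logb 2 (n * β⁻¹) with hκ
    -- The least integer strictly above `κ`, once `κ ≥ 0` is known.
    set J := ⌊κ⌋₊ + 1 with hJdef
    have hJpow : 2 * (C + 4) * N ≤ 2 ^ J := by
      refine hbig.trans ?_
      rw [← hpow, ← Real.rpow_natCast]
      apply Real.rpow_le_rpow_of_exponent_le one_le_two
      rw [hJdef]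
      push_cast
      exact (Nat.lt_floor_add_one κ).le
    have hDJ : D * N ≤ 2 ^ J := le_trans (by nlinarith) hJpow
    obtain ⟨hR1, hR2⟩ := BlockPrior.pow_level_le_rateSq hα hD1 hLD hn0 hDJ
    have hκ0 : 0 ≤ κ := by
      by_contra hneg
      have h1 : (2 : ℝ) ^ κ < 1 := Real.rpow_lt_one_of_one_lt_of_neg one_lt_two (not_le.1 hneg)
      have h2 : 1 ≤ N := Real.one_le_rpow hn1 (by positivity)
      rw [hpow] at h1
      nlinarith
    refine (measure_mono (BlockPrior.compl_sieve_subset_largeTail hα (Nat.le_add_left 1 _) hblocks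
      (le_trans (by positivity) hR1) hR2 fun k hk => ?_)).trans
      ((BlockPrior.prior_largeTail_le hα (hlevel J hDJ) hR1).trans
        (ENNReal.ofReal_le_ofReal ?_))
    · exact (Nat.floor_lt hκ0).2 hk
    · rw [mul_assoc, hNR]
      nth_rw 1 [← Real.rpow_one 2]
      rw [← Real.rpow_add two_pos]
      apply Real.rpow_le_rpow_of_exponent_le one_le_two
      linarith
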